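/- Let $\lambda>0$, $\alpha>2$ and $0<\phi\le 2\pi$. Let $\Phi=\{x_i\}$ be a homogeneous Poisson point process on $\mathbb{R}^2$ with intensity $\lambda$, and let the channel gains $h_i$ be i.i.d. copies of a random variable $h$, independent of $\Phi$, with $h>0$ almost surely and $E[h^{2/\alpha}]<\infty$. A receiver at a fixed $x\in\mathbb{R}^2$ receives from the nodes $x_i\in\Phi$ for which the angle in $[0,2\pi)$ of the vector $x_i-x$ with respect to the horizontal axis is at most $\phi$; node $i$ causes the interference power $h_i\|x-x_i\|^{-\alpha}$. For $n=1,2,\dots$ let $I_n$, the $n$-th dominant interference power, be the $n$-th largest of the interference powers of the nodes from which the receiver receives. Then for every integer $n>\alpha/2$ the random variable $I_n$ is integrable and $$E[I_n]=\left(\frac{\phi\,E[h^{2/\alpha}]\,\lambda}{2}\right)^{\alpha/2}\frac{\Gamma(n-\alpha/2)}{\Gamma(n)}.$$ -/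

import Mathlib

open MeasureTheory ProbabilityTheory

/-- The Euclidean plane, with its Lebesgue measure `volume`. -/
abbrev Plane : Type := EuclideanSpace ℝ (Fin 2)

/-- The number of points of the configuration `X 0 ω, X 1 ω, …` that lie in `B`. -/
noncomputable def pointCount {Ω E : Type*} (X : ℕ → Ω → E) (B : Set E) (ω : Ω) : ℕ∞ :=
  {i : ℕ | X i ω ∈ B}.encard

/-- The random points `X 0, X 1, …` form a Poisson point process with intensity measure `Λ`:
the number of points in a Borel set `B` of finite intensity is Poisson distributed with mean `Λ B`,
and the numbers of points in finitely many pairwise disjoint Borel sets are independent. -/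
structure IsPoissonPointProcess {Ω E : Type*} [MeasurableSpace Ω] [MeasurableSpace E]
    (X : ℕ → Ω → E) (Λ : Measure E) (P : Measure Ω) : Prop where
  measurable_point : ∀ i, Measurable (X i)
  count_law : ∀ B : Set E, MeasurableSet B → Λ B ≠ ⊤ →
    HasLaw (pointCount X B)
      ((poissonMeasure (Λ B).toNNReal).map (fun k : ℕ => (k : ℕ∞))) P
  count_indep : ∀ (m : ℕ) (B : Fin m → Set E), (∀ j, MeasurableSet (B j)) →
    Pairwise (fun j k => Disjoint (B j) (B k)) →
    iIndepFun (fun j => pointCount X (B j)) P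

/-- The random variables `h 0, h 1, …` are i.i.d. with law `ν`, and independent of the
family of points `X 0, X 1, …`. -/
structure IsIndependentMarking {Ω E : Type*} [MeasurableSpace Ω] [MeasurableSpace E]
    (X : ℕ → Ω → E) (h : ℕ → Ω → ℝ) (ν : Measure ℝ) (P : Measure Ω) : Prop where
  measurable_mark : ∀ i, Measurable (h i)
  mark_law : ∀ i, HasLaw (h i) ν P
  mark_iIndep : iIndepFun h P
  indep_points : IndepFun (fun ω i => X i ω) (fun ω i => h i ω) P

/-- The angle in `[0, 2π)` of a plane vector with respect to the horizontal axis. -/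
noncomputable def polarAngle (v : Plane) : ℝ :=
  if 0 ≤ Complex.arg ⟨v 0, v 1⟩ then Complex.arg ⟨v 0, v 1⟩
  else Complex.arg ⟨v 0, v 1⟩ + 2 * Real.pi

/-- The points from which a receiver at `x` with reception angle `φ` receives. -/
def receptionSector (x : Plane) (φ : ℝ) : Set Plane :=
  {y | polarAngle (y - x) ≤ φ}

/-- The interference power at `x` of node `i`, at position `X i` and with channel gain `h i`. -/
noncomputable def interferencePower {Ω : Type*} (X : ℕ → Ω → Plane) (h : ℕ → Ω → ℝ)
    (α : ℝ) (x : Plane) (i : ℕ) (ω : Ω) : ℝ :=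
  h i ω * ‖x - X i ω‖ ^ (-α)

/-- The `n`-th largest (`n = 1, 2, …`) of the numbers `v i`, `i ∈ S`, counted with multiplicity:
the largest threshold `t` that is reached by at least `n` of them. -/
noncomputable def nthLargest (S : Set ℕ) (v : ℕ → ℝ) (n : ℕ) : ℝ :=
  sSup {t : ℝ | (n : ℕ∞) ≤ {i | i ∈ S ∧ t ≤ v i}.encard}

/-- If the family has a strictly decreasing enumeration `v (e 0) > v (e 1) > …`, then its
`n`-th largest member is the `n`-th term of this enumeration. -/
theorem nthLargest_eq_of_strictAnti {S : Set ℕ} {v : ℕ → ℝ} (e : ℕ → ℕ)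
    (he : Set.BijOn e Set.univ S) (hv : StrictAnti (fun k => v (e k))) (n : ℕ) :
    nthLargest S v (n + 1) = v (e n) := by
  apply IsGreatest.csSup_eq
  constructor
  · have h1 : e '' (Set.Iic n) ⊆ {i | i ∈ S ∧ v (e n) ≤ v i} := by
      rintro _ ⟨k, hk, rfl⟩
      exact ⟨he.mapsTo (Set.mem_univ k), hv.antitone hk⟩
    have h2 := Set.encard_le_encard h1
    rw [(he.injOn.mono (Set.subset_univ _)).encard_image] at h2
    have h3 : (Set.Iic n).encard = ((n + 1 : ℕ) : ℕ∞) := by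
      rw [← Finset.coe_Iic, Set.encard_coe_eq_coe_finsetCard, Nat.card_Iic]
    rw [h3] at h2
    exact h2
  · intro t ht
    by_contra! hlt
    have h1 : {i | i ∈ S ∧ t ≤ v i} ⊆ e '' (Set.Iio n) := by
      rintro i ⟨hi, hti⟩
      obtain ⟨k, -, rfl⟩ := he.surjOn hi
      exact ⟨k, hv.lt_iff_gt.mp (lt_of_lt_of_le hlt hti), rfl⟩
    have h2 := (Set.encard_le_encard h1).trans (Set.encard_image_le _ _)
    have h3 : (Set.Iio n).encard = (n : ℕ∞) := by
      rw [← Finset.coe_Iio, Set.encard_coe_eq_coe_finsetCard, Nat.card_Iio]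
    rw [h3] at h2
    have h4 : ((n + 1 : ℕ) : ℕ∞) ≤ (n : ℕ∞) := le_trans ht h2
    exact absurd (Nat.cast_le.mp h4) (by omega)

/-- The `n`-th dominant interference power at a receiver at `x` with reception angle `φ`:
the `n`-th largest of the interference powers of the nodes in the reception sector. -/
noncomputable def dominantInterference {Ω : Type*} (X : ℕ → Ω → Plane) (h : ℕ → Ω → ℝ)
    (α : ℝ) (x : Plane) (φ : ℝ) (n : ℕ) (ω : Ω) : ℝ :=
  nthLargest {i | X i ω ∈ receptionSector x φ} (fun i => interferencePower X h α x i ω) n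

/-! For `t > 0`, the `n`-th largest power reaches `t` essentially when at least `n` of the marked
points `(X i, h i)` lie in `strongInterferers α x φ t`. That number is Poisson with mean `c * t ^
(-(2 / α))`, where `c = φ E[h^(2/α)] λ / 2`: for a fixed gain `k` the admissible positions form a
sector of radius `(k / t) ^ (1 / α)`, and averaging its area over `k` produces the fractional moment
(`prod_strongInterferers`). A Poisson tail is an Erlang distribution function, so the layer cake
formula turns the expectation into a double integral, which Tonelli reduces to a Gamma integral
(`lintegral_Ioi_lintegral_Ioc_gamma`).

The Poisson law of the marked count has to be derived from the counts of the unmarked points. The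
generating functional `E ∏ (1 - g (X i)) = exp (-∫ g dΛ)` holds for simple `g` by independence of
counts on disjoint fibres, and extends by `L¹` approximation (`tendsto_integral_prod`). Integrating
out the independent marks turns the generating function of a marked count into such a functional,
and a generating function determines its law (`measureReal_pointCount_eq`). -/

open Filter Topology
open scoped ENNReal NNReal

/-! ### Mean and generating function of the Poisson distribution -/

section PoissonMean

theorem lintegral_natCast_poissonMeasure (r : ℝ≥0) :
    ∫⁻ k, (k : ℝ≥0∞) ∂poissonMeasure r = r := by
  have h1 : ∫⁻ _ : ℕ, (1 : ℝ≥0∞) ∂poissonMeasure r = 1 := by simp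
  have key : ∀ f : ℕ → ℝ≥0∞, ∫⁻ k, f k ∂poissonMeasure r =
      ∑' k : ℕ, ENNReal.ofReal (Real.exp (-r) * r ^ k / (k.factorial)) * f k := by
    intro f
    rw [poissonMeasure, lintegral_sum_measure]
    simp
  rw [key] at h1 ⊢
  rw [tsum_eq_zero_add' ENNReal.summable]
  simp only [CharP.cast_eq_zero, mul_zero, zero_add]
  -- The shifted mean series is compared termwise with `r` times the series of total mass `1`.
  rw [← mul_one (r : ℝ≥0∞), ← h1, ← ENNReal.tsum_mul_left]
  refine tsum_congr fun k => ?_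
  rw [mul_one, ← ENNReal.ofReal_natCast, ← ENNReal.ofReal_mul (by positivity),
    ← ENNReal.ofReal_coe_nnreal, ← ENNReal.ofReal_mul (by positivity)]
  congr 1
  rw [Nat.factorial_succ]
  push_cast
  field_simp
  ring

theorem integral_pow_poissonMeasure (r : ℝ≥0) (c : ℝ) :
    ∫ k, c ^ k ∂poissonMeasure r = Real.exp (-((1 - c) * r)) := by
  rw [integral_poissonMeasure]
  calc ∑' k : ℕ, (Real.exp (-r) * r ^ k / (k.factorial)) • c ^ k
      = ∑' k : ℕ, Real.exp (-r) * ((r * c) ^ k / k.factorial) := by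
        refine tsum_congr fun k => ?_
        rw [smul_eq_mul, mul_pow]
        ring
    _ = Real.exp (-r) * Real.exp (r * c) := by
        rw [tsum_mul_left, Real.exp_eq_exp_ℝ,
          (NormedSpace.expSeries_div_hasSum_exp ((r : ℝ) * c)).tsum_eq]
    _ = _ := by
        rw [← Real.exp_add]
        ring_nf

end PoissonMean

/-! ### Counts and the intensity measure -/

section PointProcess

variable {Ω E : Type*} [MeasurableSpace Ω] [MeasurableSpace E] {X : ℕ → Ω → E} {Λ : Measure E}
  {P : Measure Ω}

theorem measurable_pointCount (hX : ∀ i, Measurable (X i)) {B : Set E} (hB : MeasurableSet B) :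
    Measurable (pointCount X B) := by
  refine measurable_encard.comp (measurable_set_iff.2 fun i => ?_)
  exact measurable_mem.2 (hX i hB)

theorem lintegral_pointCount (hX : ∀ i, Measurable (X i)) {B : Set E} (hB : MeasurableSet B) :
    ∫⁻ ω, (pointCount X B ω : ℝ≥0∞) ∂P = ∑' i, P.map (X i) B := by
  have h1 : ∀ ω, (pointCount X B ω : ℝ≥0∞) = ∑' i, (X i ⁻¹' B).indicator 1 ω := by
    intro ω
    rw [pointCount, ← ENNReal.tsum_set_one, tsum_subtype _ (fun _ => (1 : ℝ≥0∞))]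
    rfl
  simp_rw [h1]
  rw [lintegral_tsum fun i => (measurable_one.indicator (hX i hB)).aemeasurable]
  refine tsum_congr fun i => ?_
  rw [lintegral_indicator_one (hX i hB), Measure.map_apply (hX i) hB]

theorem ae_pointCount_ne_top (hX : ∀ i, Measurable (X i)) {B : Set E} (hB : MeasurableSet B)
    (hfin : ∑' i, P.map (X i) B ≠ ⊤) : ∀ᵐ ω ∂P, pointCount X B ω ≠ ⊤ := by
  rw [← lintegral_pointCount hX hB] at hfin
  have hm : Measurable fun ω => (pointCount X B ω : ℝ≥0∞) :=
    Measurable.of_discrete.comp (measurable_pointCount hX hB)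
  filter_upwards [ae_lt_top hm hfin] with ω hω h
  simp [h] at hω

namespace IsPoissonPointProcess

theorem tsum_map_apply (hX : IsPoissonPointProcess X Λ P) {B : Set E} (hB : MeasurableSet B)
    (hfin : Λ B ≠ ⊤) : ∑' i, P.map (X i) B = Λ B := by
  rw [← lintegral_pointCount hX.measurable_point hB,
    (hX.count_law B hB hfin).lintegral_comp (f := fun k : ℕ∞ => (k : ℝ≥0∞))
      Measurable.of_discrete.aemeasurable,
    lintegral_map .of_discrete .of_discrete]
  simp only [ENat.toENNReal_coe]
  rw [lintegral_natCast_poissonMeasure, ENNReal.coe_toNNReal hfin]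

/-- Campbell's formula at the level of measures: the mean of the Poisson count identifies the two
sides on sets of finite intensity, and σ-finiteness extends this to all sets. It turns sums of
expectations over the points into integrals against `Λ`. -/
theorem sum_map_eq [SigmaFinite Λ] (hX : IsPoissonPointProcess X Λ P) :
    Measure.sum (fun i => P.map (X i)) = Λ := by
  refine Measure.ext_of_iUnion_eq_univ (iUnion_spanningSets Λ) fun k => ?_
  ext B hB
  have hBk := hB.inter (measurableSet_spanningSets Λ k)
  rw [Measure.restrict_apply hB, Measure.restrict_apply hB, Measure.sum_apply _ hBk]
  exact hX.tsum_map_apply hBk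
    (measure_ne_top_of_subset Set.inter_subset_right (measure_spanningSets_lt_top Λ k).ne)

theorem integral_pow_pointCount (hX : IsPoissonPointProcess X Λ P) {B : Set E}
    (hB : MeasurableSet B) (hfin : Λ B ≠ ⊤) (c : ℝ) :
    ∫ ω, c ^ (pointCount X B ω).toNat ∂P = Real.exp (-((1 - c) * (Λ B).toReal)) := by
  have := (hX.count_law B hB hfin).integral_comp (f := fun k : ℕ∞ => c ^ k.toNat)
    Measurable.of_discrete.aestronglyMeasurable
  refine this.trans ?_
  rw [integral_map .of_discrete (Measurable.of_discrete.aestronglyMeasurable)]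
  simp only [ENat.toNat_natCast]
  rw [integral_pow_poissonMeasure]
  rfl

end IsPoissonPointProcess

end PointProcess

/-! ### The probability generating functional -/

theorem Finset.abs_prod_sub_prod_le {ι : Type*} (s : Finset ι) (a b : ι → ℝ)
    (ha : ∀ i, a i ∈ Set.Icc (0 : ℝ) 1) (hb : ∀ i, b i ∈ Set.Icc (0 : ℝ) 1) :
    |∏ i ∈ s, a i - ∏ i ∈ s, b i| ≤ ∑ i ∈ s, |a i - b i| := by
  classical
  induction s using Finset.induction_on with
  | empty => simp
  | insert j s hj ih =>
    rw [Finset.prod_insert hj, Finset.prod_insert hj, Finset.sum_insert hj]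
    have h1 : a j * ∏ i ∈ s, a i - b j * ∏ i ∈ s, b i =
        (a j - b j) * ∏ i ∈ s, a i + b j * (∏ i ∈ s, a i - ∏ i ∈ s, b i) := by ring
    have h2 : |∏ i ∈ s, a i| ≤ 1 := by
      rw [abs_of_nonneg (Finset.prod_nonneg fun i _ => (ha i).1)]
      exact Finset.prod_le_one (fun i _ => (ha i).1) fun i _ => (ha i).2
    have h3 : |b j| ≤ 1 := by
      rw [abs_of_nonneg (hb j).1]
      exact (hb j).2
    rw [h1]
    refine (abs_add_le _ _).trans ?_
    rw [abs_mul, abs_mul]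
    exact add_le_add (mul_le_of_le_one_right (abs_nonneg _) h2)
      ((mul_le_of_le_one_left (abs_nonneg _) h3).trans ih)

theorem Finset.prod_mem_Icc {ι : Type*} (s : Finset ι) (a : ι → ℝ)
    (ha : ∀ i, a i ∈ Set.Icc (0 : ℝ) 1) : ∏ i ∈ s, a i ∈ Set.Icc (0 : ℝ) 1 :=
  ⟨Finset.prod_nonneg fun i _ => (ha i).1,
    Finset.prod_le_one (fun i _ => (ha i).1) fun i _ => (ha i).2⟩

/-- If the members of a finite set `S` of indices carry the factor `c` and all other indices the
factor `1`, the partial products are eventually equal to `c ^ S.ncard`. -/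
theorem tendsto_pow_card_filter {S : Set ℕ} [DecidablePred (· ∈ S)] (hS : S.Finite) (c : ℝ) :
    Tendsto (fun M => c ^ ((Finset.range M).filter (· ∈ S)).card) atTop
      (𝓝 (c ^ S.encard.toNat)) := by
  obtain ⟨b, hb⟩ := hS.bddAbove
  refine tendsto_const_nhds.congr' ?_
  filter_upwards [eventually_gt_atTop b] with M hM
  congr 1
  have : S = ((Finset.range M).filter (· ∈ S) : Finset ℕ) := by
    ext i
    simp only [Finset.coe_filter, Finset.mem_range, Set.mem_ofPred_eq]
    exact ⟨fun h => ⟨(hb h).trans_lt hM, h⟩, fun h => h.2⟩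
  rw [← Set.ncard_coe_finset, ← this, Set.ncard_def]

namespace IsPoissonPointProcess

variable {Ω E : Type*} [MeasurableSpace Ω] [MeasurableSpace E] {X : ℕ → Ω → E} {Λ : Measure E}
  {P : Measure Ω}

/-- The difference of products is at most the sum of the differences, and the laws of the first `M`
points sum to at most `Λ`. The bound does not depend on `M`, which permits approximating the factors
before `M → ∞`. -/
theorem abs_integral_prod_sub_le [SigmaFinite Λ] [IsProbabilityMeasure P]
    (hX : IsPoissonPointProcess X Λ P) {u v : E → ℝ}
    (hu : Measurable u) (hv : Measurable v) (hu1 : ∀ y, u y ∈ Set.Icc (0 : ℝ) 1)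
    (hv1 : ∀ y, v y ∈ Set.Icc (0 : ℝ) 1) (huv : Integrable (fun y => u y - v y) Λ) (M : ℕ) :
    |∫ ω, ∏ i ∈ Finset.range M, u (X i ω) ∂P - ∫ ω, ∏ i ∈ Finset.range M, v (X i ω) ∂P| ≤
      ∫ y, |u y - v y| ∂Λ := by
  have hmX := hX.measurable_point
  have hint : ∀ w : E → ℝ, Measurable w → (∀ y, w y ∈ Set.Icc (0 : ℝ) 1) →
      Integrable (fun ω => ∏ i ∈ Finset.range M, w (X i ω)) P := by
    intro w hw hw1
    refine Integrable.of_mem_Icc 0 1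
      (Finset.measurable_fun_prod _ fun i _ => hw.comp (hmX i)).aemeasurable
      (Eventually.of_forall fun ω => Finset.prod_mem_Icc _ _ fun i => hw1 _)
  have habs : Integrable (fun y => |u y - v y|) (Measure.sum fun i => P.map (X i)) := by
    rw [hX.sum_map_eq]
    exact huv.abs
  have hi : ∀ i, Integrable (fun y => |u y - v y|) (P.map (X i)) := fun i =>
    habs.mono_measure (Measure.le_sum _ i)
  have hi' : ∀ i, Integrable (fun ω => |u (X i ω) - v (X i ω)|) P := fun i =>
    (hi i).comp_measurable (hmX i)
  rw [← integral_sub (hint u hu hu1) (hint v hv hv1)]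
  calc |∫ ω, (∏ i ∈ Finset.range M, u (X i ω) - ∏ i ∈ Finset.range M, v (X i ω)) ∂P|
      ≤ ∫ ω, |∏ i ∈ Finset.range M, u (X i ω) - ∏ i ∈ Finset.range M, v (X i ω)| ∂P :=
        abs_integral_le_integral_abs
    _ ≤ ∫ ω, ∑ i ∈ Finset.range M, |u (X i ω) - v (X i ω)| ∂P := by
        refine integral_mono ((hint u hu hu1).sub (hint v hv hv1)).abs
          (integrable_finsetSum _ fun i _ => hi' i) fun ω => ?_
        exact Finset.abs_prod_sub_prod_le _ _ _ (fun i => hu1 _) fun i => hv1 _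
    _ = ∑ i ∈ Finset.range M, ∫ y, |u y - v y| ∂P.map (X i) := by
        rw [integral_finsetSum _ fun i _ => hi' i]
        refine Finset.sum_congr rfl fun i _ => ?_
        rw [integral_map (hmX i).aemeasurable (hi i).aestronglyMeasurable]
    _ ≤ ∫ y, |u y - v y| ∂Λ := by
        have hs := hasSum_integral_measure habs
        rw [hX.sum_map_eq] at hs
        exact sum_le_hasSum _ (fun i _ => integral_nonneg fun y => abs_nonneg _) hs

open Classical in
-- Grouping the points by the value of `g` gives a product of powers `(1 - c) ^ count` over disjoint
-- fibres. The counts are independent and Poisson, so the exponents of the generating functions add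
-- up to the integral of `g`.
theorem tendsto_integral_prod_simpleFunc [IsProbabilityMeasure P]
    (hX : IsPoissonPointProcess X Λ P) (g : SimpleFunc E ℝ) (hg : ∀ y, g y ∈ Set.Icc (0 : ℝ) 1)
    (hgi : Integrable g Λ) :
    Tendsto (fun M => ∫ ω, ∏ i ∈ Finset.range M, (1 - g (X i ω)) ∂P) atTop
      (𝓝 (Real.exp (-∫ y, g y ∂Λ))) := by
  have hmX := hX.measurable_point
  -- The fibre over `0` may have infinite intensity; it contributes only factors `1` and is dropped.
  set R : Finset ℝ := g.range.filter (· ≠ 0) with hR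
  have hfin : ∀ c : R, Λ (g ⁻¹' {(c : ℝ)}) ≠ ⊤ := fun c =>
    (SimpleFunc.integrable_iff.1 hgi c (Finset.mem_filter.1 c.2).2).ne
  have hmB : ∀ c : R, MeasurableSet (g ⁻¹' {(c : ℝ)}) := fun c => g.measurableSet_fiber _
  have hindep : iIndepFun (fun c : R => pointCount X (g ⁻¹' {(c : ℝ)})) P := by
    have e := R.equivFin
    have h1 := hX.count_indep R.card (fun j => g ⁻¹' {(e.symm j : ℝ)}) (fun j => hmB _) <| by
      intro j k hjk
      refine Set.disjoint_left.2 fun y hj hk => hjk ?_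
      exact e.symm.injective (Subtype.ext (hj.symm.trans hk))
    have h2 := h1.precomp e.injective
    convert h2 using 3 with c
    simp
  have hlim : ∫ ω, ∏ c : R, (1 - (c : ℝ)) ^ (pointCount X (g ⁻¹' {(c : ℝ)}) ω).toNat ∂P =
      Real.exp (-∫ y, g y ∂Λ) := by
    rw [hindep.integral_fun_prod_comp (f := fun (c : R) (k : ℕ∞) => (1 - (c : ℝ)) ^ k.toNat)
      (fun c => (measurable_pointCount hmX (hmB c)).aemeasurable)
      (fun c => Measurable.of_discrete.aestronglyMeasurable)]
    simp_rw [hX.integral_pow_pointCount (hmB _) (hfin _)]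
    rw [← Real.exp_sum, ← SimpleFunc.integral_eq_integral g hgi,
      SimpleFunc.integral_eq_sum_filter]
    congr 1
    rw [Finset.sum_neg_distrib, ← Finset.sum_coe_sort R (fun c => Λ.real (g ⁻¹' {c}) • c)]
    congr 1
    refine Finset.sum_congr rfl fun c _ => ?_
    rw [smul_eq_mul, sub_sub_cancel, mul_comm]
    rfl
  have hprod : ∀ ω M, ∏ i ∈ Finset.range M, (1 - g (X i ω)) =
      ∏ c : R, (1 - (c : ℝ)) ^
        ((Finset.range M).filter (· ∈ {i | X i ω ∈ g ⁻¹' {(c : ℝ)}})).card := by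
    intro ω M
    rw [← Finset.prod_fiberwise_of_maps_to (s := Finset.range M) (t := g.range)
      (g := fun i => g (X i ω)) fun i _ => g.mem_range_self _]
    rw [Finset.prod_coe_sort R (fun c => (1 - c) ^
      ((Finset.range M).filter (· ∈ {i | X i ω ∈ g ⁻¹' {c}})).card)]
    rw [hR, Finset.prod_filter_of_ne]
    · refine Finset.prod_congr rfl fun c _ => ?_
      rw [Finset.prod_congr rfl (g := fun _ => 1 - c), Finset.prod_const]
      · rfl
      · intro i hi
        rw [(Finset.mem_filter.1 hi).2]
    · rintro c - hc rfl
      simp at hc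
  rw [← hlim]
  refine tendsto_integral_of_dominated_convergence (fun _ => 1) ?_ (integrable_const _) ?_ ?_
  · exact fun M => (Finset.measurable_fun_prod _ fun i _ =>
      measurable_const.sub (g.measurable.comp (hmX i))).aestronglyMeasurable
  · refine fun M => Eventually.of_forall fun ω => ?_
    have := Finset.prod_mem_Icc (Finset.range M) (fun i => 1 - g (X i ω))
      fun i => ⟨sub_nonneg.2 (hg _).2, sub_le_self _ (hg _).1⟩
    rw [Real.norm_eq_abs, abs_of_nonneg this.1]
    exact this.2
  · have hae : ∀ᵐ ω ∂P, ∀ c : R, pointCount X (g ⁻¹' {(c : ℝ)}) ω ≠ ⊤ := by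
      refine ae_all_iff.2 fun c => ae_pointCount_ne_top hmX (hmB c) ?_
      rw [hX.tsum_map_apply (hmB c) (hfin c)]
      exact hfin c
    filter_upwards [hae] with ω hω
    simp_rw [hprod]
    exact tendsto_finsetProd _ fun c _ =>
      tendsto_pow_card_filter (Set.encard_ne_top_iff.1 (hω c)) _

/-- The probability generating functional of a Poisson point process. -/
theorem tendsto_integral_prod [SigmaFinite Λ] [IsProbabilityMeasure P]
    (hX : IsPoissonPointProcess X Λ P) {g : E → ℝ} (hgm : Measurable g)
    (hg : ∀ y, g y ∈ Set.Icc (0 : ℝ) 1) (hgi : Integrable g Λ) :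
    Tendsto (fun M => ∫ ω, ∏ i ∈ Finset.range M, (1 - g (X i ω)) ∂P) atTop
      (𝓝 (Real.exp (-∫ y, g y ∂Λ))) := by
  have h0 : (0 : ℝ) ∈ Set.Icc (0 : ℝ) 1 := by simp
  set a : ℕ → SimpleFunc E ℝ := SimpleFunc.approxOn g hgm (Set.Icc 0 1) 0 h0 with ha
  have hai : ∀ k, Integrable (a k) Λ := fun k =>
    SimpleFunc.integrable_approxOn hgm hgi h0 (integrable_zero _ _ _) k
  have ham : ∀ k y, a k y ∈ Set.Icc (0 : ℝ) 1 := fun k y => SimpleFunc.approxOn_mem hgm h0 k y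
  have hL1 : Tendsto (fun k => ∫⁻ y, ‖a k y - g y‖ₑ ∂Λ) atTop (𝓝 0) :=
    SimpleFunc.tendsto_approxOn_L1_enorm hgm h0
      (Eventually.of_forall fun y => subset_closure (hg y)) (by simpa using hgi.2)
  have hL1' : Tendsto (fun k => ∫ y, |a k y - g y| ∂Λ) atTop (𝓝 0) := by
    have h1 : ∀ k, ∫ y, |a k y - g y| ∂Λ = (∫⁻ y, ‖a k y - g y‖ₑ ∂Λ).toReal := fun k =>
      integral_norm_eq_lintegral_enorm ((hai k).sub hgi).aestronglyMeasurable
    simp_rw [h1]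
    exact (ENNReal.tendsto_toReal ENNReal.zero_ne_top).comp hL1
  have hint : Tendsto (fun k => ∫ y, a k y ∂Λ) atTop (𝓝 (∫ y, g y ∂Λ)) :=
    tendsto_integral_of_L1 g hgi.aestronglyMeasurable (Eventually.of_forall hai) hL1
  have hexp : Tendsto (fun k => Real.exp (-∫ y, a k y ∂Λ)) atTop
      (𝓝 (Real.exp (-∫ y, g y ∂Λ))) := (Real.continuous_exp.tendsto _).comp hint.neg
  rw [Metric.tendsto_atTop]
  intro ε hε
  obtain ⟨k, hk1, hk2⟩ := ((hL1'.eventually (gt_mem_nhds (show (0 : ℝ) < ε / 3 by linarith))).and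
    (Metric.tendsto_nhds.1 hexp (ε / 3) (by linarith))).exists
  obtain ⟨N, hN⟩ := Metric.tendsto_atTop.1
    (hX.tendsto_integral_prod_simpleFunc (a k) (ham k) (hai k)) (ε / 3) (by linarith)
  refine ⟨N, fun M hM => ?_⟩
  have h1 := hN M hM
  have hIcc : ∀ {t : ℝ}, t ∈ Set.Icc (0 : ℝ) 1 → 1 - t ∈ Set.Icc (0 : ℝ) 1 := fun ht =>
    ⟨sub_nonneg.2 ht.2, sub_le_self _ ht.1⟩
  have hsub : ∀ y, 1 - g y - (1 - a k y) = a k y - g y := fun y => by ring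
  have h2 := hX.abs_integral_prod_sub_le (u := fun y => 1 - g y) (v := fun y => 1 - a k y)
    (measurable_const.sub hgm) (measurable_const.sub (a k).measurable)
    (fun y => hIcc (hg y)) (fun y => hIcc (ham k y))
    (by simp only [hsub]; exact (hai k).sub hgi) M
  simp only [hsub] at h2
  rw [Real.dist_eq] at *
  rw [abs_lt] at *
  rw [abs_le] at h2
  constructor <;> linarith [h1.1, h1.2, hk2.1, hk2.2, h2.1, h2.2]

end IsPoissonPointProcess

/-! ### Uniqueness of generating functions and the marking theorem -/

/-- Bounded coefficients make the sum analytic at `0`, and its zeros accumulate there from the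
right, so the identity theorem applies. -/
theorem eq_zero_of_hasSum_pow_eq_zero {d : ℕ → ℝ} {C : ℝ} (hd : ∀ k, |d k| ≤ C)
    (h : ∀ s ∈ Set.Ioo (0 : ℝ) 1, HasSum (fun k => d k * s ^ k) 0) : d = 0 := by
  set f : ℝ → ℝ := fun s => ∑' k, d k * s ^ k with hf
  have hp : HasFPowerSeriesAt f (FormalMultilinearSeries.ofScalars ℝ d) 0 := by
    rw [hasFPowerSeriesAt_iff]
    filter_upwards [Metric.ball_mem_nhds (0 : ℝ) one_pos] with s hs
    have hs' : |s| < 1 := by simpa using hs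
    have hsum : Summable fun k => d k * s ^ k := by
      refine Summable.of_norm_bounded
        ((summable_geometric_of_lt_one (abs_nonneg s) hs').mul_left C) fun k => ?_
      rw [Real.norm_eq_abs, abs_mul, abs_pow]
      exact mul_le_mul_of_nonneg_right (hd k) (by positivity)
    simpa [hf, FormalMultilinearSeries.coeff_ofScalars, mul_comm] using hsum.hasSum
  have hfreq : ∃ᶠ s in 𝓝[≠] (0 : ℝ), f s = 0 := by
    have h1 : ∀ᶠ s in 𝓝[>] (0 : ℝ), f s = 0 := by
      filter_upwards [Ioo_mem_nhdsGT (one_pos (α := ℝ))] with s hs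
      exact (h s hs).tsum_eq
    exact h1.frequently.filter_mono (nhdsWithin_mono _ fun s hs => (ne_of_gt hs))
  have hev : f =ᶠ[𝓝 0] 0 :=
    hp.analyticAt.frequently_eq_iff_eventually_eq analyticAt_const |>.1 hfreq
  have hp0 := (hp.congr hev).eq_zero
  funext k
  have := congrArg (fun q => q.coeff k) hp0
  rw [FormalMultilinearSeries.coeff_ofScalars] at this
  exact this.trans (by simp [FormalMultilinearSeries.coeff])

section Marking

variable {Ω E : Type*} [MeasurableSpace Ω] [MeasurableSpace E] {X : ℕ → Ω → E} {Λ : Measure E}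
  {P : Measure Ω} {h : ℕ → Ω → ℝ} {ν : Measure ℝ}

namespace IsIndependentMarking

theorem isProbabilityMeasure [IsProbabilityMeasure P] (hh : IsIndependentMarking X h ν P) :
    IsProbabilityMeasure ν :=
  (hh.mark_law 0).isProbabilityMeasure_iff.1 inferInstance

theorem map_prodMk [IsProbabilityMeasure P] (hX : ∀ i, Measurable (X i))
    (hh : IsIndependentMarking X h ν P) (i : ℕ) :
    P.map (fun ω => (X i ω, h i ω)) = (P.map (X i)).prod ν := by
  have h1 : IndepFun (X i) (h i) P :=
    hh.indep_points.comp (measurable_pi_apply i) (measurable_pi_apply i)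
  rw [(indepFun_iff_map_prod_eq_prod_map_map (hX i).aemeasurable
    (hh.measurable_mark i).aemeasurable).1 h1, (hh.mark_law i).map_eq]

/-- Fubini: given the points, the first `M` marks have law `ν^M`, so the inner integral of the
product factorizes. -/
theorem integral_prod_eq [IsProbabilityMeasure P] (hX : ∀ i, Measurable (X i))
    (hh : IsIndependentMarking X h ν P) {F : E × ℝ → ℝ} (hF : Measurable F)
    (hF1 : ∀ z, F z ∈ Set.Icc (0 : ℝ) 1) (M : ℕ) :
    ∫ ω, ∏ i ∈ Finset.range M, F (X i ω, h i ω) ∂P =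
      ∫ ω, ∏ i ∈ Finset.range M, ∫ k, F (X i ω, k) ∂ν ∂P := by
  have := hh.isProbabilityMeasure
  set Xs : Ω → ℕ → E := fun ω i => X i ω
  set Hs : Ω → Fin M → ℝ := fun ω i => h i ω
  have hXs : Measurable Xs := measurable_pi_lambda _ hX
  have hHs : Measurable Hs := measurable_pi_lambda _ fun i => hh.measurable_mark i
  have hind : IndepFun Xs Hs P :=
    hh.indep_points.comp (ψ := fun (k : ℕ → ℝ) (i : Fin M) => k i) measurable_id (by fun_prop)
  have hmapH : P.map Hs = Measure.pi fun _ : Fin M => ν := by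
    have h1 := iIndepFun.map_fun_eq_pi_map (fun i : Fin M => (hh.measurable_mark i).aemeasurable)
      (hh.mark_iIndep.precomp (g := fun i : Fin M => (i : ℕ)) Fin.val_injective)
    simp_rw [(hh.mark_law _).map_eq] at h1
    exact h1
  have hmap : P.map (fun ω => (Xs ω, Hs ω)) = (P.map Xs).prod (Measure.pi fun _ : Fin M => ν) := by
    rw [(indepFun_iff_map_prod_eq_prod_map_map hXs.aemeasurable hHs.aemeasurable).1 hind, hmapH]
  have := Measure.isProbabilityMeasure_map (μ := P) hXs.aemeasurable
  set G : (ℕ → E) × (Fin M → ℝ) → ℝ := fun z => ∏ i : Fin M, F (z.1 i, z.2 i)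
  have hG : Measurable G := by
    refine Finset.measurable_fun_prod _ fun i _ => hF.comp ?_
    fun_prop
  have hGi : Integrable G ((P.map Xs).prod (Measure.pi fun _ : Fin M => ν)) :=
    Integrable.of_mem_Icc 0 1 hG.aemeasurable
      (Eventually.of_forall fun z => Finset.prod_mem_Icc _ _ fun i => hF1 _)
  calc ∫ ω, ∏ i ∈ Finset.range M, F (X i ω, h i ω) ∂P
      = ∫ ω, G (Xs ω, Hs ω) ∂P := by
        simp_rw [Finset.prod_range]
        rfl
    _ = ∫ z, G z ∂(P.map Xs).prod (Measure.pi fun _ : Fin M => ν) := by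
        rw [← hmap, integral_map (hXs.prodMk hHs).aemeasurable hG.aestronglyMeasurable]
    _ = ∫ x, ∫ k, G (x, k) ∂Measure.pi (fun _ : Fin M => ν) ∂P.map Xs := integral_prod _ hGi
    _ = ∫ x, ∏ i : Fin M, ∫ k, F (x i, k) ∂ν ∂P.map Xs := by
        congr 1
        funext x
        exact integral_fintype_prod_eq_prod (fun (i : Fin M) k => F (x i, k))
    _ = _ := by
        rw [integral_map hXs.aemeasurable]
        · simp_rw [Finset.prod_range]
          rfl
        · refine (Finset.measurable_fun_prod _ fun i _ => ?_).aestronglyMeasurable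
          have h1 : StronglyMeasurable fun y : E => ∫ k, F (y, k) ∂ν :=
            hF.stronglyMeasurable.integral_prod_right'
          exact h1.measurable.comp (measurable_pi_apply _)

theorem tsum_map_apply [IsProbabilityMeasure P] [SigmaFinite Λ]
    (hX : IsPoissonPointProcess X Λ P) (hh : IsIndependentMarking X h ν P) {A : Set (E × ℝ)}
    (hA : MeasurableSet A) :
    ∑' i, P.map (fun ω => (X i ω, h i ω)) A = (Λ.prod ν) A := by
  have := hh.isProbabilityMeasure
  simp_rw [hh.map_prodMk hX.measurable_point, Measure.prod_apply hA]
  rw [← hX.sum_map_eq, lintegral_sum_measure]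

open Classical in
-- Each marked point in `A` gets the factor `s`, every other one the factor `1`. Integrating out its
-- mark leaves a point at `y` with the factor `1 - (1 - s) * p y`, where `p y` is the `ν`-mass of
-- the section of `A` at `y`. The generating functional then applies, with `∫ p dΛ = (Λ.prod ν) A`.
theorem integral_pow_pointCount [IsProbabilityMeasure P] [SigmaFinite Λ]
    (hX : IsPoissonPointProcess X Λ P) (hh : IsIndependentMarking X h ν P) {A : Set (E × ℝ)}
    (hA : MeasurableSet A) (hfin : (Λ.prod ν) A ≠ ⊤) {s : ℝ} (hs : s ∈ Set.Ioo (0 : ℝ) 1) :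
    ∫ ω, s ^ (pointCount (fun i ω => (X i ω, h i ω)) A ω).toNat ∂P =
      Real.exp (-((1 - s) * ((Λ.prod ν) A).toReal)) := by
  have := hh.isProbabilityMeasure
  have hmZ : ∀ i, Measurable fun ω => (X i ω, h i ω) := fun i =>
    (hX.measurable_point i).prodMk (hh.measurable_mark i)
  set F : E × ℝ → ℝ := A.piecewise (fun _ => s) (fun _ => 1) with hFdef
  have hF : Measurable F := measurable_const.piecewise hA measurable_const
  have hF1 : ∀ z, F z ∈ Set.Icc (0 : ℝ) 1 := by
    intro z
    by_cases hz : z ∈ A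
    · simpa [hFdef, hz] using ⟨hs.1.le, hs.2.le⟩
    · simp [hFdef, hz]
  set p : E → ℝ := fun y => ν.real (Prod.mk y ⁻¹' A) with hp
  have hpm : Measurable p := (measurable_measure_prodMk_left hA).ennreal_toReal
  have hpi : Integrable p Λ := by
    refine ⟨hpm.aestronglyMeasurable, ?_⟩
    rw [hasFiniteIntegral_iff_enorm, lt_top_iff_ne_top]
    convert hfin using 1
    rw [Measure.prod_apply hA]
    refine lintegral_congr fun y => ?_
    rw [Real.enorm_of_nonneg measureReal_nonneg, ofReal_measureReal]
  have hpint : ∫ y, p y ∂Λ = ((Λ.prod ν) A).toReal := by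
    rw [Measure.prod_apply hA]
    exact integral_toReal (measurable_measure_prodMk_left hA).aemeasurable
      (Eventually.of_forall fun y => measure_lt_top _ _)
  have hFp : ∀ y, ∫ k, F (y, k) ∂ν = 1 - (1 - s) * p y := by
    intro y
    have hAy : MeasurableSet (Prod.mk y ⁻¹' A) := measurable_prodMk_left hA
    have h1 : ∀ k, F (y, k) = 1 - (1 - s) * (Prod.mk y ⁻¹' A).indicator 1 k := by
      intro k
      by_cases hz : (y, k) ∈ A <;> simp [hFdef, hz]
    simp_rw [h1]
    have h2 : Integrable ((Prod.mk y ⁻¹' A).indicator (1 : ℝ → ℝ)) ν :=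
      (integrable_const (1 : ℝ)).indicator hAy
    rw [integral_sub (integrable_const _) (h2.const_mul _), integral_const_mul, integral_indicator_one hAy]
    simp [hp]
  have hlim1 := hX.tendsto_integral_prod (g := fun y => (1 - s) * p y) (hpm.const_mul _)
    (fun y => ⟨mul_nonneg (by linarith [hs.2]) measureReal_nonneg,
      mul_le_one₀ (by linarith [hs.1]) measureReal_nonneg measureReal_le_one⟩) (hpi.const_mul _)
  rw [integral_const_mul, hpint] at hlim1
  have hae : ∀ᵐ ω ∂P, pointCount (fun i ω => (X i ω, h i ω)) A ω ≠ ⊤ := by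
    refine ae_pointCount_ne_top hmZ hA ?_
    rwa [hh.tsum_map_apply hX hA]
  -- The same partial products converge, by domination, to the generating function of the marked
  -- count, which is almost surely finite.
  refine tendsto_nhds_unique ?_ hlim1
  simp_rw [← hFp, ← hh.integral_prod_eq hX.measurable_point hF hF1]
  refine tendsto_integral_of_dominated_convergence (fun _ => 1) ?_ (integrable_const _) ?_ ?_
  · exact fun M => (Finset.measurable_fun_prod _ fun i _ =>
      hF.comp (hmZ i)).aestronglyMeasurable
  · refine fun M => Eventually.of_forall fun ω => ?_
    have := Finset.prod_mem_Icc (Finset.range M) (fun i => F (X i ω, h i ω)) fun i => hF1 _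
    rw [Real.norm_eq_abs, abs_of_nonneg this.1]
    exact this.2
  · filter_upwards [hae] with ω hω
    have h1 : ∀ M, ∏ i ∈ Finset.range M, F (X i ω, h i ω) =
        s ^ ((Finset.range M).filter (· ∈ {i | (X i ω, h i ω) ∈ A})).card := by
      intro M
      simp [hFdef, Set.piecewise, Finset.prod_ite]
    simp_rw [h1]
    exact tendsto_pow_card_filter (Set.encard_ne_top_iff.1 hω) _

/-- The number of marked points in a set of finite intensity is Poisson distributed. -/
theorem measureReal_pointCount_eq [IsProbabilityMeasure P] [SigmaFinite Λ]
    (hX : IsPoissonPointProcess X Λ P) (hh : IsIndependentMarking X h ν P) {A : Set (E × ℝ)}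
    (hA : MeasurableSet A) (hfin : (Λ.prod ν) A ≠ ⊤) (n : ℕ) :
    P.real {ω | (pointCount (fun i ω => (X i ω, h i ω)) A ω).toNat = n} =
      Real.exp (-((Λ.prod ν) A).toReal) * ((Λ.prod ν) A).toReal ^ n / n.factorial := by
  set r : ℝ≥0 := ((Λ.prod ν) A).toNNReal with hr
  have hmZ : ∀ i, Measurable fun ω => (X i ω, h i ω) := fun i =>
    (hX.measurable_point i).prodMk (hh.measurable_mark i)
  set N : Ω → ℕ := fun ω => (pointCount (fun i ω => (X i ω, h i ω)) A ω).toNat with hN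
  have hNm : Measurable N := Measurable.of_discrete.comp (measurable_pointCount hmZ hA)
  have := Measure.isProbabilityMeasure_map (μ := P) hNm.aemeasurable
  have hpow : ∀ (μ : Measure ℕ) [IsProbabilityMeasure μ], ∀ s ∈ Set.Ioo (0 : ℝ) 1,
      HasSum (fun k => μ.real {k} * s ^ k) (∫ k, s ^ k ∂μ) := by
    intro μ _ s hs
    have hi : Integrable (fun k : ℕ => s ^ k) μ :=
      Integrable.of_mem_Icc 0 1 Measurable.of_discrete.aemeasurable
        (Eventually.of_forall fun k => ⟨pow_nonneg hs.1.le _, pow_le_one₀ hs.1.le hs.2.le⟩)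
    have h1 := hasSum_integral_iUnion (fun k : ℕ => MeasurableSet.singleton k)
      (fun i j hij => by simpa [Function.onFun] using hij) (f := fun k : ℕ => s ^ k) (μ := μ)
      hi.integrableOn
    simpa [integral_singleton, setIntegral_univ, Set.iUnion_of_singleton, measureReal_def] using h1
  have hd := eq_zero_of_hasSum_pow_eq_zero
    (d := fun k => (P.map N).real {k} - (poissonMeasure r).real {k}) (C := 1) (fun k => by
      rw [abs_le]
      constructor <;> linarith [measureReal_le_one (μ := P.map N) (s := {k}),
        measureReal_le_one (μ := poissonMeasure r) (s := {k}),
        measureReal_nonneg (μ := P.map N) (s := {k}),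
        measureReal_nonneg (μ := poissonMeasure r) (s := {k})]) (fun s hs => by
      have h1 := (hpow (P.map N) s hs).sub (hpow (poissonMeasure r) s hs)
      rw [integral_map hNm.aemeasurable Measurable.of_discrete.aestronglyMeasurable,
        hh.integral_pow_pointCount hX hA hfin hs, integral_pow_poissonMeasure] at h1
      rw [show ((r : ℝ≥0) : ℝ) = ((Λ.prod ν) A).toReal from rfl, sub_self] at h1
      simpa only [sub_mul] using h1)
  have h1 := sub_eq_zero.1 (congrFun hd n)
  rw [poissonMeasure_real_singleton, map_measureReal_apply hNm (.singleton n)] at h1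
  exact h1

end IsIndependentMarking

end Marking

/-! ### Poisson tails and the layer cake formula -/

/-- The distribution function of the Erlang distribution, in terms of the Poisson distribution. -/
theorem integral_pow_mul_exp_neg_div_factorial (n : ℕ) (m : ℝ) :
    ∫ s in (0 : ℝ)..m, s ^ n * Real.exp (-s) / n.factorial =
      1 - ∑ j ∈ Finset.range (n + 1), Real.exp (-m) * m ^ j / j.factorial := by
  have hd : ∀ k : ℕ, ∀ s : ℝ, HasDerivAt
      (fun s : ℝ => 1 - ∑ j ∈ Finset.range (k + 1), Real.exp (-s) * s ^ j / j.factorial)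
      (s ^ k * Real.exp (-s) / k.factorial) s := by
    intro k s
    have hexp : HasDerivAt (fun s : ℝ => Real.exp (-s)) (-Real.exp (-s)) s := by
      simpa using (hasDerivAt_id s).neg.exp
    induction k with
    | zero => simpa using hexp.const_sub 1
    | succ k ih =>
      -- The derivative telescopes: the new summand cancels the old density and leaves the next one.
      have h1 := ih.sub ((hexp.mul (hasDerivAt_pow (k + 1) s)).div_const ((k + 1).factorial : ℝ))
      convert! h1 using 1
      · funext s
        rw [Finset.sum_range_succ _ (k + 1)]
        simp only [Pi.sub_apply, Pi.mul_apply]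
        ring
      · rw [Nat.factorial_succ]
        push_cast
        field_simp
        simp
  rw [intervalIntegral.integral_eq_sub_of_hasDerivAt (fun s _ => hd n s)
    ((by fun_prop : Continuous fun s : ℝ => s ^ n * Real.exp (-s) / n.factorial).intervalIntegrable
      _ _)]
  simp [Finset.sum_range_succ']

theorem IsIndependentMarking.measure_le_pointCount {Ω E : Type*} [MeasurableSpace Ω]
    [MeasurableSpace E] {X : ℕ → Ω → E} {Λ : Measure E} {P : Measure Ω} {h : ℕ → Ω → ℝ}
    {ν : Measure ℝ} [IsProbabilityMeasure P] [SigmaFinite Λ]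
    (hX : IsPoissonPointProcess X Λ P) (hh : IsIndependentMarking X h ν P) {A : Set (E × ℝ)}
    (hA : MeasurableSet A) (hfin : (Λ.prod ν) A ≠ ⊤) (n : ℕ) :
    P {ω | ((n + 1 : ℕ) : ℕ∞) ≤ pointCount (fun i ω => (X i ω, h i ω)) A ω} =
      ∫⁻ s in Set.Ioc 0 ((Λ.prod ν) A).toReal,
        ENNReal.ofReal (s ^ n * Real.exp (-s) / n.factorial) := by
  have hmZ : ∀ i, Measurable fun ω => (X i ω, h i ω) := fun i =>
    (hX.measurable_point i).prodMk (hh.measurable_mark i)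
  set N := pointCount (fun i ω => (X i ω, h i ω)) A with hN
  set m := ((Λ.prod ν) A).toReal with hm
  have hNm : Measurable N := measurable_pointCount hmZ hA
  have hNt : Measurable fun ω => (N ω).toNat := Measurable.of_discrete.comp hNm
  have hae : ∀ᵐ ω ∂P, N ω ≠ ⊤ := by
    refine ae_pointCount_ne_top hmZ hA ?_
    rwa [hh.tsum_map_apply hX hA]
  -- Only almost surely the same event: `toNat` sends an infinite count to `0`.
  have h1 : P {ω | ((n + 1 : ℕ) : ℕ∞) ≤ N ω} = P {ω | (N ω).toNat ∈ Finset.range (n + 1)}ᶜ := by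
    refine measure_congr ?_
    filter_upwards [hae] with ω hω
    refine propext ?_
    obtain ⟨k, hk⟩ := ENat.ne_top_iff_exists.1 hω
    change ((n + 1 : ℕ) : ℕ∞) ≤ N ω ↔ ¬ ((N ω).toNat ∈ Finset.range (n + 1))
    rw [← hk, Nat.cast_le]
    simp
  have h2 : P.real {ω | (N ω).toNat ∈ Finset.range (n + 1)} =
      ∑ j ∈ Finset.range (n + 1), Real.exp (-m) * m ^ j / j.factorial := by
    have h3 := map_measureReal_apply (μ := P) hNt (Finset.range (n + 1)).measurableSet
    have h4 := sum_measureReal_singleton (μ := P.map fun ω => (N ω).toNat)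
      (s := Finset.range (n + 1))
    rw [h3] at h4
    refine h4.symm.trans (Finset.sum_congr rfl fun j _ => ?_)
    rw [map_measureReal_apply hNt (.singleton j)]
    exact hh.measureReal_pointCount_eq hX hA hfin j
  have hcont : Continuous fun s : ℝ => s ^ n * Real.exp (-s) / n.factorial := by fun_prop
  have hmR : MeasurableSet {ω | (N ω).toNat ∈ Finset.range (n + 1)} :=
    hNt (Finset.range (n + 1)).measurableSet
  rw [h1, ← ofReal_measureReal, probReal_compl_eq_one_sub hmR, h2,
    ← integral_pow_mul_exp_neg_div_factorial, intervalIntegral.integral_of_le ENNReal.toReal_nonneg,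
    ofReal_integral_eq_lintegral_ofReal
      ((hcont.integrableOn_Icc (a := 0) (b := m)).mono_set Set.Ioc_subset_Icc_self)]
  filter_upwards [ae_restrict_mem measurableSet_Ioc] with s hs
  have := hs.1.le
  positivity

/-- Layer cake formula, with the tail function only given up to its jumps. -/
theorem lintegral_ofReal_eq_of_tail {Ω : Type*} [MeasurableSpace Ω] {P : Measure Ω} {I : Ω → ℝ}
    (hI : AEMeasurable I P) (hI0 : 0 ≤ᵐ[P] I) {f : ℝ → ℝ≥0∞}
    (hlt : ∀ t > 0, P {ω | t < I ω} ≤ f t) (hle : ∀ t > 0, f t ≤ P {ω | t ≤ I ω}) :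
    ∫⁻ ω, ENNReal.ofReal (I ω) ∂P = ∫⁻ t in Set.Ioi (0 : ℝ), f t := by
  refine le_antisymm ?_ ?_
  · rw [lintegral_eq_lintegral_meas_lt P hI0 hI]
    exact setLIntegral_mono' measurableSet_Ioi fun t ht => hlt t ht
  · rw [lintegral_eq_lintegral_meas_le P hI0 hI]
    exact setLIntegral_mono' measurableSet_Ioi fun t ht => hle t ht

/-! ### Threshold properties of the `n`-th largest value -/

section NthLargest

variable {S : Set ℕ} {v : ℕ → ℝ} {n : ℕ}

theorem encard_le_antitone : Antitone fun t : ℝ => {i | i ∈ S ∧ t ≤ v i}.encard :=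
  fun _ _ hst => Set.encard_le_encard fun _ hi => ⟨hi.1, hst.trans hi.2⟩

theorem bddAbove_nthLargest {b : ℝ} (hb : ¬ (n : ℕ∞) ≤ {i | i ∈ S ∧ b ≤ v i}.encard) :
    BddAbove {t : ℝ | (n : ℕ∞) ≤ {i | i ∈ S ∧ t ≤ v i}.encard} :=
  ⟨b, fun _ ht => le_of_not_gt fun hbt => hb (le_trans ht (encard_le_antitone hbt.le))⟩

theorem le_nthLargest {b : ℝ} (hb : ¬ (n : ℕ∞) ≤ {i | i ∈ S ∧ b ≤ v i}.encard) {t : ℝ}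
    (ht : (n : ℕ∞) ≤ {i | i ∈ S ∧ t ≤ v i}.encard) : t ≤ nthLargest S v n :=
  le_csSup (bddAbove_nthLargest hb) ht

theorem le_encard_of_lt_nthLargest {t : ℝ} (ht0 : 0 ≤ t) (ht : t < nthLargest S v n) :
    (n : ℕ∞) ≤ {i | i ∈ S ∧ t ≤ v i}.encard := by
  have hne : {t : ℝ | (n : ℕ∞) ≤ {i | i ∈ S ∧ t ≤ v i}.encard}.Nonempty := by
    by_contra h
    rw [Set.not_nonempty_iff_eq_empty] at h
    rw [nthLargest, h, Real.sSup_empty] at ht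
    -- The supremum of the empty set is `0`, which is why `t` must be nonnegative.
    exact absurd ht (not_lt.2 ht0)
  obtain ⟨s, hs, hts⟩ := exists_lt_of_lt_csSup hne ht
  exact le_trans hs (encard_le_antitone hts.le)

theorem nthLargest_nonneg (hv : ∀ i, 0 ≤ v i) : 0 ≤ nthLargest S v n := by
  by_cases h0 : (n : ℕ∞) ≤ {i | i ∈ S ∧ 0 ≤ v i}.encard
  · by_cases hbdd : BddAbove {t : ℝ | (n : ℕ∞) ≤ {i | i ∈ S ∧ t ≤ v i}.encard}
    · exact le_csSup hbdd h0
    · rw [nthLargest, Real.sSup_of_not_bddAbove hbdd]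
  · refine Real.sSup_nonneg fun t ht => le_of_not_gt fun ht0 => h0 ?_
    refine le_trans ht (Set.encard_le_encard fun i hi => ⟨hi.1, hv i⟩)

open Classical in
-- Rational thresholds suffice, by monotonicity. The countable supremum makes the `n`-th largest
-- value almost everywhere measurable.
theorem nthLargest_eq_iSup (hv : ∀ i, 0 ≤ v i) {b : ℝ}
    (hb : ¬ (n : ℕ∞) ≤ {i | i ∈ S ∧ b ≤ v i}.encard) :
    nthLargest S v n = ⨆ q : ℚ,
      if (n : ℕ∞) ≤ {i | i ∈ S ∧ (q : ℝ) ≤ v i}.encard then max (q : ℝ) 0 else 0 := by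
  have h0 := nthLargest_nonneg (S := S) (n := n) hv
  have hub : ∀ q : ℚ, (if (n : ℕ∞) ≤ {i | i ∈ S ∧ (q : ℝ) ≤ v i}.encard then max (q : ℝ) 0 else 0) ≤
      nthLargest S v n := by
    intro q
    split_ifs with hq
    · exact max_le (le_nthLargest hb hq) h0
    · exact h0
  refine le_antisymm (le_of_forall_lt fun t ht => ?_) (ciSup_le hub)
  have hbdd : BddAbove (Set.range fun q : ℚ =>
      if (n : ℕ∞) ≤ {i | i ∈ S ∧ (q : ℝ) ≤ v i}.encard then max (q : ℝ) 0 else 0) :=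
    ⟨_, Set.forall_mem_range.2 hub⟩
  rcases lt_or_ge t 0 with ht0 | ht0
  · refine lt_of_lt_of_le ht0 (le_trans ?_ (le_ciSup hbdd 0))
    split_ifs <;> simp
  · obtain ⟨q, hq1, hq2⟩ := exists_rat_btwn ht
    have := le_encard_of_lt_nthLargest (ht0.trans hq1.le) hq2
    refine lt_of_lt_of_le hq1 (le_trans ?_ (le_ciSup hbdd q))
    rw [if_pos this]
    exact le_max_left _ _

end NthLargest

/-! ### The Gamma integral -/

/-- By Tonelli, integrate over `t` first: for fixed `s` it ranges over `(0, (c / s) ^ β]`. The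
length `(c / s) ^ β` lowers the exponent of `s` by `β`, and `β < n + 1` is exactly convergence at
`0`. -/
theorem lintegral_Ioi_lintegral_Ioc_gamma {β c : ℝ} (hβ : 0 < β) (hc : 0 ≤ c) {n : ℕ}
    (hn : β < n + 1) :
    ∫⁻ t in Set.Ioi (0 : ℝ), ∫⁻ s in Set.Ioc 0 (c * t ^ (-β⁻¹)),
        ENNReal.ofReal (s ^ n * Real.exp (-s) / n.factorial) =
      ENNReal.ofReal (c ^ β * (Real.Gamma (n + 1 - β) / n.factorial)) := by
  set γ : ℝ → ℝ≥0∞ := fun s => ENNReal.ofReal (s ^ n * Real.exp (-s) / n.factorial) with hγ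
  have hγm : Measurable γ := by fun_prop
  have hiff : ∀ s > 0, ∀ t > 0, (s ≤ c * t ^ (-β⁻¹) ↔ t ≤ (c / s) ^ β) := by
    intro s hs t ht
    rw [Real.rpow_neg ht.le, ← div_eq_mul_inv, le_div_iff₀ (Real.rpow_pos_of_pos ht _),
      ← le_div_iff₀' hs]
    simpa using (Real.le_rpow_inv_iff_of_pos ht.le (div_nonneg hc hs.le) (inv_pos.2 hβ)).symm
  have h1 : ∀ t ∈ Set.Ioi (0 : ℝ), ∫⁻ s in Set.Ioc 0 (c * t ^ (-β⁻¹)), γ s =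
      ∫⁻ s in Set.Ioi (0 : ℝ), (Set.Iic ((c / s) ^ β)).indicator (fun _ => γ s) t := by
    intro t ht
    rw [← Set.Ioi_inter_Iic, Set.inter_comm, ← setLIntegral_indicator measurableSet_Iic]
    refine setLIntegral_congr_fun measurableSet_Ioi fun s hs => ?_
    simp only [Set.indicator_apply, Set.mem_Iic, hiff s hs t ht]
  rw [setLIntegral_congr_fun measurableSet_Ioi h1, lintegral_lintegral_swap]
  · have h2 : ∀ s ∈ Set.Ioi (0 : ℝ),
        ∫⁻ t in Set.Ioi (0 : ℝ), (Set.Iic ((c / s) ^ β)).indicator (fun _ => γ s) t =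
          ENNReal.ofReal (c ^ β / n.factorial * (Real.exp (-s) * s ^ (n + 1 - β - 1))) := by
      intro s hs
      have hs : 0 < s := hs
      rw [lintegral_indicator measurableSet_Iic, Measure.restrict_restrict measurableSet_Iic,
        lintegral_const, Measure.restrict_apply_univ, Set.inter_comm, Set.Ioi_inter_Iic,
        Real.volume_Ioc, hγ, ← ENNReal.ofReal_mul (by positivity)]
      congr 1
      rw [sub_zero, Real.div_rpow hc hs.le,
        show (n : ℝ) + 1 - β - 1 = (n : ℝ) - β by ring, Real.rpow_sub hs, Real.rpow_natCast]
      ring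
    rw [setLIntegral_congr_fun measurableSet_Ioi h2, ← ofReal_integral_eq_lintegral_ofReal]
    · rw [integral_const_mul, ← Real.Gamma_eq_integral (by linarith)]
      congr 1
      ring
    · exact (Real.GammaIntegral_convergent (by linarith)).const_mul _
    · filter_upwards [ae_restrict_mem measurableSet_Ioi] with s hs
      have hs : 0 < s := hs
      have := Real.rpow_nonneg hc β
      positivity
  · refine Measurable.aemeasurable ?_
    have h3 : Measurable fun z : ℝ × ℝ => γ z.2 := hγm.comp measurable_snd
    have h4 : MeasurableSet {z : ℝ × ℝ | z.1 ≤ (c / z.2) ^ β} :=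
      measurableSet_le measurable_fst (by fun_prop)
    exact h3.indicator h4

/-! ### Area of the reception sector -/

theorem measurable_polarAngle : Measurable polarAngle := by
  have h1 : Measurable fun v : Plane => (Complex.arg ⟨v 0, v 1⟩) :=
    Complex.measurable_arg.comp (Complex.measurableEquivRealProd.symm.measurable.comp
      (f := fun v : Plane => (v 0, v 1)) (by fun_prop))
  exact Measurable.ite (measurableSet_le measurable_const h1) h1 (h1.add_const _)

theorem measurableSet_receptionSector (x : Plane) (φ : ℝ) :
    MeasurableSet (receptionSector x φ) :=
  measurableSet_le (measurable_polarAngle.comp (measurable_id.sub_const x)) measurable_const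

theorem volume_angle_le {φ : ℝ} (hφ : 0 < φ) (hφ' : φ ≤ 2 * Real.pi) :
    volume (Set.Ioo (-Real.pi) Real.pi ∩ {θ | (if 0 ≤ θ then θ else θ + 2 * Real.pi) ≤ φ}) =
      ENNReal.ofReal φ := by
  have hpi := Real.pi_pos
  -- Negative arguments correspond to angles above `π`. They are all excluded if `φ < π`; otherwise
  -- just those in `(φ - 2π, 0)` are.
  rcases lt_or_ge φ Real.pi with h | h
  · have : Set.Ioo (-Real.pi) Real.pi ∩ {θ | (if 0 ≤ θ then θ else θ + 2 * Real.pi) ≤ φ} =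
        Set.Icc 0 φ := by
      ext θ
      simp only [Set.mem_inter_iff, Set.mem_Ioo, Set.mem_ofPred_eq, Set.mem_Icc]
      split_ifs <;> constructor <;> rintro ⟨h1, h2⟩ <;> (try constructor) <;>
        (try constructor) <;> linarith
    rw [this, Real.volume_Icc, sub_zero]
  · have : Set.Ioo (-Real.pi) Real.pi ∩ {θ | (if 0 ≤ θ then θ else θ + 2 * Real.pi) ≤ φ} =
        Set.Ioo (-Real.pi) Real.pi \ Set.Ioo (φ - 2 * Real.pi) 0 := by
      ext θ
      simp only [Set.mem_inter_iff, Set.mem_Ioo, Set.mem_ofPred_eq, Set.mem_sdiff, not_and, not_lt]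
      refine and_congr_right fun hθ => ?_
      split_ifs with h0
      · exact ⟨fun _ _ => h0, fun _ => by linarith [hθ.2]⟩
      · refine ⟨fun h1 h2 => by linarith, fun h1 => ?_⟩
        by_contra! h2
        exact h0 (h1 (by linarith))
    rw [this, measure_sdiff (Set.Ioo_subset_Ioo (by linarith) (by linarith))
      measurableSet_Ioo.nullMeasurableSet (by simp), Real.volume_Ioo, Real.volume_Ioo,
      ← ENNReal.ofReal_sub _ (by linarith)]
    congr 1
    ring

theorem lintegral_Ioc_ofReal_id {r : ℝ} (hr : 0 ≤ r) :
    ∫⁻ s in Set.Ioc 0 r, ENNReal.ofReal s = ENNReal.ofReal (r ^ 2 / 2) := by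
  rw [← ofReal_integral_eq_lintegral_ofReal
    ((continuous_id'.integrableOn_Icc (a := (0 : ℝ)) (b := r)).mono_set Set.Ioc_subset_Icc_self),
    ← intervalIntegral.integral_of_le hr]
  · congr 1
    simp
  · filter_upwards [ae_restrict_mem measurableSet_Ioc] with s hs using hs.1.le

/-- The isometry with `ℂ` preserves volume, and in polar coordinates the indicator splits into a
radial and an angular factor. -/
theorem volume_sector {φ r : ℝ} (hφ : 0 < φ) (hφ' : φ ≤ 2 * Real.pi) (hr : 0 ≤ r) :
    volume {v : Plane | polarAngle v ≤ φ ∧ ‖v‖ ≤ r} = ENNReal.ofReal (φ / 2 * r ^ 2) := by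
  have hS : MeasurableSet {v : Plane | polarAngle v ≤ φ ∧ ‖v‖ ≤ r} :=
    (measurableSet_le measurable_polarAngle measurable_const).inter
      (measurableSet_le measurable_norm measurable_const)
  have hmp := Complex.orthonormalBasisOneI.measurePreserving_repr
  set Θ : Set ℝ := {θ | (if 0 ≤ θ then θ else θ + 2 * Real.pi) ≤ φ} with hΘ
  have hΘm : MeasurableSet Θ :=
    measurableSet_le (Measurable.ite (measurableSet_le measurable_const measurable_id)
      measurable_id (measurable_id.add_const _)) measurable_const
  have hpre : Complex.orthonormalBasisOneI.repr ⁻¹' {v : Plane | polarAngle v ≤ φ ∧ ‖v‖ ≤ r} =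
      {z : ℂ | Complex.arg z ∈ Θ ∧ ‖z‖ ≤ r} := by
    ext z
    simp [polarAngle, hΘ]
  rw [← hmp.measure_preimage hS.nullMeasurableSet, hpre]
  have hS' : MeasurableSet {z : ℂ | Complex.arg z ∈ Θ ∧ ‖z‖ ≤ r} :=
    (Complex.measurable_arg hΘm).inter (measurableSet_le measurable_norm measurable_const)
  rw [← lintegral_indicator_one hS', ← Complex.lintegral_comp_polarCoord_symm]
  have h1 : ∀ p ∈ polarCoord.target, ENNReal.ofReal p.1 •
      ({z : ℂ | Complex.arg z ∈ Θ ∧ ‖z‖ ≤ r}.indicator 1 (Complex.polarCoord.symm p) : ℝ≥0∞) =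
        (Set.Iic r).indicator (fun s => ENNReal.ofReal s) p.1 * Θ.indicator 1 p.2 := by
    rintro ⟨s, θ⟩ ⟨hs, hθ⟩
    have hs : 0 < s := hs
    have harg : Complex.arg (Complex.polarCoord.symm (s, θ)) = θ := by
      rw [Complex.polarCoord_symm_apply]
      simpa using Complex.arg_mul_cos_add_sin_mul_I hs (Set.Ioo_subset_Ioc_self hθ)
    have hnorm : ‖Complex.polarCoord.symm (s, θ)‖ = s := by
      rw [Complex.norm_polarCoord_symm, abs_of_pos hs]
    have hmem : Complex.polarCoord.symm (s, θ) ∈ {z : ℂ | Complex.arg z ∈ Θ ∧ ‖z‖ ≤ r} ↔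
        θ ∈ Θ ∧ s ≤ r := by
      rw [Set.mem_ofPred_eq, harg, hnorm]
    by_cases h2 : s ≤ r <;> by_cases h3 : θ ∈ Θ <;>
      simp only [Set.indicator_apply, hmem, Set.mem_Iic, h2, h3] <;> simp
  rw [setLIntegral_congr_fun polarCoord.open_target.measurableSet h1, polarCoord_target,
    Measure.volume_eq_prod, ← Measure.prod_restrict, lintegral_prod_mul]
  · rw [lintegral_indicator_one hΘm, setLIntegral_indicator measurableSet_Iic,
      Measure.restrict_apply hΘm, Set.inter_comm (Set.Iic r), Set.Ioi_inter_Iic,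
      lintegral_Ioc_ofReal_id hr, Set.inter_comm, volume_angle_le hφ hφ',
      ← ENNReal.ofReal_mul (by positivity)]
    congr 1
    ring
  · exact (Measurable.indicator (by fun_prop) measurableSet_Iic).aemeasurable
  · exact (measurable_one.indicator hΘm).aemeasurable

theorem volume_receptionSector_inter_closedBall (x : Plane) {φ r : ℝ} (hφ : 0 < φ)
    (hφ' : φ ≤ 2 * Real.pi) (hr : 0 ≤ r) :
    volume (receptionSector x φ ∩ Metric.closedBall x r) = ENNReal.ofReal (φ / 2 * r ^ 2) := by
  have hS : MeasurableSet {v : Plane | polarAngle v ≤ φ ∧ ‖v‖ ≤ r} :=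
    (measurableSet_le measurable_polarAngle measurable_const).inter
      (measurableSet_le measurable_norm measurable_const)
  rw [← volume_sector hφ hφ' hr,
    ← (measurePreserving_sub_right volume x).measure_preimage hS.nullMeasurableSet]
  congr 1

/-! ### Intensity of the strong interferers -/

/-- The positions in the sector and the channel gains that cause an interference power
of at least `t`. -/
def strongInterferers (α : ℝ) (x : Plane) (φ t : ℝ) : Set (Plane × ℝ) :=
  {z | z.1 ∈ receptionSector x φ ∧ t ≤ z.2 * ‖x - z.1‖ ^ (-α)}

theorem measurableSet_strongInterferers (α : ℝ) (x : Plane) (φ t : ℝ) :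
    MeasurableSet (strongInterferers α x φ t) :=
  (measurable_fst (measurableSet_receptionSector x φ)).inter <|
    measurableSet_le (f := fun _ : Plane × ℝ => t) (g := fun z => z.2 * ‖x - z.1‖ ^ (-α))
      measurable_const (by fun_prop)

theorem volume_strongInterferers_section {α φ t k : ℝ} (hα : 0 < α) (x : Plane) (hφ : 0 < φ)
    (hφ' : φ ≤ 2 * Real.pi) (ht : 0 < t) (hk : 0 < k) :
    volume ((fun y => (y, k)) ⁻¹' strongInterferers α x φ t) =
      ENNReal.ofReal (φ / 2 * t ^ (-(2 / α)) * k ^ (2 / α)) := by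
  have h1 : ((fun y => (y, k)) ⁻¹' strongInterferers α x φ t) =ᵐ[volume]
      (receptionSector x φ ∩ Metric.closedBall x ((k / t) ^ α⁻¹) : Set Plane) := by
    -- At `y = x` the convention `0 ^ (-α) = 0` makes the power vanish, although the ball contains
    -- its centre; this point is null.
    have hx : ∀ᵐ y : Plane, y ≠ x := by simp [ae_iff]
    filter_upwards [hx] with y hy
    have hd : 0 < ‖x - y‖ := norm_pos_iff.2 (sub_ne_zero.2 hy.symm)
    refine propext (and_congr_right fun _ => ?_)
    change t ≤ k * ‖x - y‖ ^ (-α) ↔ dist y x ≤ _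
    rw [dist_comm, dist_eq_norm, Real.le_rpow_inv_iff_of_pos hd.le (by positivity) hα,
      Real.rpow_neg hd.le, ← div_eq_mul_inv, le_div_iff₀ (by positivity), le_div_iff₀ ht, mul_comm]
  rw [measure_congr h1, volume_receptionSector_inter_closedBall x hφ hφ' (by positivity)]
  congr 1
  rw [← Real.rpow_natCast, ← Real.rpow_mul (by positivity), Real.div_rpow hk.le ht.le,
    Real.rpow_neg ht.le, show α⁻¹ * ((2 : ℕ) : ℝ) = 2 / α by push_cast; ring]
  ring

theorem prod_strongInterferers {lam α φ t : ℝ} (hlam : 0 < lam) (hα : 0 < α) (x : Plane)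
    (hφ : 0 < φ) (hφ' : φ ≤ 2 * Real.pi) (ht : 0 < t) {ν : Measure ℝ} [IsProbabilityMeasure ν]
    (hpos : ∀ᵐ u ∂ν, 0 < u) (hmom : Integrable (fun u : ℝ => u ^ (2 / α)) ν) :
    ((ENNReal.ofReal lam • (volume : Measure Plane)).prod ν) (strongInterferers α x φ t) =
      ENNReal.ofReal (φ * (∫ u, u ^ (2 / α) ∂ν) * lam / 2 * t ^ (-(2 / α))) := by
  rw [Measure.prod_smul_left, Measure.smul_apply,
    Measure.prod_apply_symm (measurableSet_strongInterferers α x φ t)]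
  have h1 : ∀ᵐ k ∂ν, volume ((fun y => (y, k)) ⁻¹' strongInterferers α x φ t) =
      ENNReal.ofReal (φ / 2 * t ^ (-(2 / α)) * k ^ (2 / α)) := by
    filter_upwards [hpos] with k hk
      using volume_strongInterferers_section hα x hφ hφ' ht hk
  rw [lintegral_congr_ae h1, ← ofReal_integral_eq_lintegral_ofReal (hmom.const_mul _),
    integral_const_mul, smul_eq_mul, ← ENNReal.ofReal_mul hlam.le]
  · congr 1
    ring
  · filter_upwards [hpos] with k hk
    have hk : 0 < k := hk
    positivity

/-! ### The mean of the dominant interference -/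

theorem mainTheorem3 {Ω : Type*} [MeasurableSpace Ω] (P : Measure Ω) [IsProbabilityMeasure P]
    (lam α φ : ℝ) (hlam : 0 < lam) (hα : 2 < α) (hφ : 0 < φ) (hφ' : φ ≤ 2 * Real.pi)
    (X : ℕ → Ω → Plane) (h : ℕ → Ω → ℝ) (ν : Measure ℝ)
    (hX : IsPoissonPointProcess X (ENNReal.ofReal lam • (volume : Measure Plane)) P)
    (hh : IsIndependentMarking X h ν P)
    (hpos : ∀ᵐ u ∂ν, 0 < u)
    (hmom : Integrable (fun u : ℝ => u ^ (2 / α)) ν)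
    (x : Plane) (n : ℕ) (hn : α / 2 < n) :
    Integrable (dominantInterference X h α x φ n) P ∧
      ∫ ω, dominantInterference X h α x φ n ω ∂P =
        (φ * (∫ u, u ^ (2 / α) ∂ν) * lam / 2) ^ (α / 2) *
          (Real.Gamma (n - α / 2) / Real.Gamma n) := by
  classical
  have hα0 : 0 < α := by linarith
  have := hh.isProbabilityMeasure
  have : SigmaFinite (ENNReal.ofReal lam • (volume : Measure Plane)) :=
    inferInstanceAs (SigmaFinite (lam.toNNReal • (volume : Measure Plane)))
  obtain ⟨k, rfl⟩ : ∃ k, n = k + 1 := by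
    refine Nat.exists_eq_add_one_of_ne_zero ?_
    rintro rfl
    norm_num at hn
    linarith
  have hmZ : ∀ i, Measurable fun ω => (X i ω, h i ω) := fun i =>
    (hX.measurable_point i).prodMk (hh.measurable_mark i)
  set c : ℝ := φ * (∫ u, u ^ (2 / α) ∂ν) * lam / 2 with hc
  have hc0 : 0 ≤ c := by
    have : 0 ≤ ∫ u, u ^ (2 / α) ∂ν := integral_nonneg_of_ae <| by
      filter_upwards [hpos] with u hu using Real.rpow_nonneg (le_of_lt hu) _
    positivity
  set N : ℝ → Ω → ℕ∞ := fun t =>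
    pointCount (fun i ω => (X i ω, h i ω)) (strongInterferers α x φ t) with hN
  have hNm : ∀ t, MeasurableSet {ω | ((k + 1 : ℕ) : ℕ∞) ≤ N t ω} := fun t =>
    measurable_pointCount hmZ (measurableSet_strongInterferers α x φ t) (.of_discrete (s := Set.Ici _))
  set f : ℝ → ℝ≥0∞ := fun t => ∫⁻ s in Set.Ioc 0 (c * t ^ (-(2 / α))),
    ENNReal.ofReal (s ^ k * Real.exp (-s) / k.factorial) with hf
  have htail : ∀ t > 0, P {ω | ((k + 1 : ℕ) : ℕ∞) ≤ N t ω} = f t := by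
    intro t ht
    have hm := prod_strongInterferers hlam hα0 x hφ hφ' ht hpos hmom
    rw [hN, hh.measure_le_pointCount hX (measurableSet_strongInterferers α x φ t)
      (by rw [hm]; exact ENNReal.ofReal_ne_top), hm, ENNReal.toReal_ofReal (by positivity)]
  -- The Erlang density is at most `1`, since `s ^ k / k! ≤ exp s`.
  have hfle : ∀ t, f t ≤ ENNReal.ofReal (c * t ^ (-(2 / α))) := by
    intro t
    calc f t ≤ ∫⁻ s in Set.Ioc 0 (c * t ^ (-(2 / α))), 1 := by
          refine setLIntegral_mono' measurableSet_Ioc fun s hs => ?_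
          rw [ENNReal.ofReal_le_one, mul_div_right_comm, Real.exp_neg, ← div_eq_mul_inv,
            div_le_one (Real.exp_pos s)]
          exact Real.pow_div_factorial_le_exp s hs.1.le k
      _ = _ := by simp
  -- Almost surely the set of thresholds is bounded above, so its `sSup` is not the default value of
  -- an unbounded set: the tail `f t` tends to `0` along `t = j + 1`.
  have hbdd : ∀ᵐ ω ∂P, ∃ b : ℝ, ¬ ((k + 1 : ℕ) : ℕ∞) ≤ N b ω := by
    have hlim : Tendsto (fun j : ℕ => ENNReal.ofReal (c * ((j : ℝ) + 1) ^ (-(2 / α)))) atTop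
        (𝓝 0) := by
      have h1 : Tendsto (fun j : ℕ => (j : ℝ) + 1) atTop atTop :=
        tendsto_atTop_add_const_right _ _ tendsto_natCast_atTop_atTop
      have h2 := ((tendsto_rpow_neg_atTop (show 0 < 2 / α by positivity)).comp h1).const_mul c
      simpa using ENNReal.tendsto_ofReal h2
    have h0 : P {ω | ¬ ∃ b : ℝ, ¬ ((k + 1 : ℕ) : ℕ∞) ≤ N b ω} ≤ 0 := by
      refine ge_of_tendsto' hlim fun j => ?_
      refine le_trans (measure_mono fun ω hω => ?_)
        ((htail ((j : ℝ) + 1) (by positivity)).le.trans (hfle _))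
      by_contra hb
      exact hω ⟨_, hb⟩
    exact le_antisymm h0 zero_le
  have hmarks : ∀ᵐ ω ∂P, ∀ i, 0 < h i ω := ae_all_iff.2 fun i =>
    ((hh.mark_law i).ae_iff (p := fun u => 0 < u) (measurableSet_setOfPred.1 measurableSet_Ioi)).2 hpos
  have hpow : ∀ᵐ ω ∂P, ∀ i, 0 ≤ interferencePower X h α x i ω := by
    filter_upwards [hmarks] with ω hω i
    exact mul_nonneg (hω i).le (Real.rpow_nonneg (norm_nonneg _) _)
  set I := dominantInterference X h α x φ (k + 1) with hI
  have hI0 : 0 ≤ᵐ[P] I := by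
    filter_upwards [hpow] with ω hω using nthLargest_nonneg hω
  have hIm : AEMeasurable I P := by
    refine ⟨fun ω => ⨆ q : ℚ, if ((k + 1 : ℕ) : ℕ∞) ≤ N q ω then max (q : ℝ) 0 else 0, ?_, ?_⟩
    · exact Measurable.iSup fun q => Measurable.ite (hNm q) measurable_const measurable_const
    · filter_upwards [hpow, hbdd] with ω hω ⟨b, hb⟩
      exact nthLargest_eq_iSup hω hb
  have hlint : ∫⁻ ω, ENNReal.ofReal (I ω) ∂P = ENNReal.ofReal
      (c ^ (α / 2) * (Real.Gamma ((k + 1 : ℕ) - α / 2) / Real.Gamma (k + 1 : ℕ))) := by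
    -- Up to null sets, `{t < I}` lies in the event that at least `k + 1` powers in the sector reach
    -- `t`, and this event lies in `{t ≤ I}`.
    rw [lintegral_ofReal_eq_of_tail hIm hI0 (f := f)]
    · have h1 := lintegral_Ioi_lintegral_Ioc_gamma (β := α / 2) (n := k) (by positivity) hc0
        (by exact_mod_cast hn)
      rw [inv_div] at h1
      rw [hf, h1]
      push_cast
      rw [Real.Gamma_nat_eq_factorial]
    · intro t ht
      rw [← htail t ht]
      exact measure_mono fun ω hω => le_encard_of_lt_nthLargest ht.le hω
    · intro t ht
      rw [← htail t ht]
      refine measure_mono_ae ?_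
      filter_upwards [hbdd] with ω ⟨b, hb⟩ hω
      exact le_nthLargest hb hω
  have hint : Integrable I P := by
    refine ⟨hIm.aestronglyMeasurable, ?_⟩
    rw [hasFiniteIntegral_iff_ofReal hI0, hlint]
    exact ENNReal.ofReal_lt_top
  refine ⟨hint, ?_⟩
  rw [integral_eq_lintegral_of_nonneg_ae hI0 hIm.aestronglyMeasurable, hlint,
    ENNReal.toReal_ofReal]
  have h1 : 0 < Real.Gamma ((k + 1 : ℕ) - α / 2) := Real.Gamma_pos_of_pos (by linarith)
  have h2 : 0 < Real.Gamma (k + 1 : ℕ) := Real.Gamma_pos_of_pos (by positivity)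
  exact mul_nonneg (Real.rpow_nonneg hc0 _) (div_pos h1 h2).le
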